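/- Identify the power set $\mathcal P(\omega)$ with the Cantor set ${}^\omega 2$ (with the product topology) via characteristic functions, and give every subset of $\mathcal P(\omega)$ the subspace topology. A separable space $X$ is called countable dense homogeneous if for any two countable dense subsets $D, E$ of $X$ there is a homeomorphism $h : X \to X$ with $h[D] = E$. A filter $\mathcal F$ on $\omega$ is called a $P$-filter if for every sequence $(X_n)_{n<\omega}$ of elements of $\mathcal F$ there is $X \in \mathcal F$ such that $X \setminus X_n$ is finite for all $n < \omega$. **Theorem.** Let $\mathcal F \subset \mathcal P(\omega)$ be a proper filter on $\omega$ which contains the Fréchet filter $\{x \subset \omega : \omega \setminus x \text{ is finite}\}$, is a $P$-filter, and is non-meager as a subset of $\mathcal P(\omega)$. Then both $\mathcal F$ (with the subspace topology) and its countable power ${}^\omega\mathcal F$ (with the product topology) are countable dense homogeneous. -/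

import Mathlib

/-- A topological space `X` is countable dense homogeneous if it is separable and any two countable
dense subsets of `X` are carried one onto the other by some homeomorphism of `X` onto itself. -/
def IsCDH (X : Type*) [TopologicalSpace X] : Prop :=
  TopologicalSpace.SeparableSpace X ∧
    ∀ D E : Set X, D.Countable → Dense D → E.Countable → Dense E → ∃ h : X ≃ₜ X, h '' D = E

/-- A filter on `ℕ` is a P-filter if every sequence of its members has a pseudo-intersection
that is again a member. -/
def IsPFilter (F : Filter ℕ) : Prop :=
  ∀ X : ℕ → Set ℕ, (∀ n, X n ∈ F) → ∃ Y ∈ F, ∀ n, (Y \ X n).Finite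

/-- The family of members of a filter on `ℕ`, as a subset of the Cantor set `ℕ → Bool` (with the
product topology); a subset of `ℕ` is identified with its characteristic function. -/
def cantorFamily (F : Filter ℕ) : Set (ℕ → Bool) :=
  {x | {n : ℕ | x n = true} ∈ F}

/-! Let `D`, `E` be countable dense subsets of the filter. The P-property gives a member `x` almost
contained in every point of `D ∪ E`. Choose a partition into intervals growing so fast that each
pattern below one endpoint is realized in `D` and in `E` by points containing `x` beyond the next
endpoint. Non-meagerness (Talagrand) gives a member `A` missing infinitely many intervals. Put `y =
x ∩ A`. The missed intervals leave room to approximate freely off `y` while copying a point on `y`,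
so a back-and-forth builds an isometric bijection `D → E` fixing coordinates in `y`. It extends to
the Cantor set, and the extension preserves the filter because it changes nothing on `y ∈ F`.

The countable power is the family of another filter, `sectionFilter F`, which inherits the
properties used, so the same argument applies. -/

/-! ### Extending partial isometries of the Cantor set -/

/-- A back-and-forth condition on pairs of binary sequences: the first coordinates split at the
same place as the second ones. -/
def SplitAlike (p q : (ℕ → Bool) × (ℕ → Bool)) : Prop :=
  ∀ n, (∀ i < n, p.1 i = q.1 i) ↔ ∀ i < n, p.2 i = q.2 i

theorem SplitAlike.symm {p q : (ℕ → Bool) × (ℕ → Bool)} (h : SplitAlike p q) : SplitAlike q p := by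
  intro n
  simpa only [eq_comm] using h n

theorem SplitAlike.swap {p q : (ℕ → Bool) × (ℕ → Bool)} (h : SplitAlike p q) :
    SplitAlike p.swap q.swap :=
  fun n => (h n).symm

theorem SplitAlike.refl (p : (ℕ → Bool) × (ℕ → Bool)) : SplitAlike p p :=
  fun _ => by simp

/-- A set of binary sequences meeting every cylinder. -/
def MeetsCylinders (D : Set (ℕ → Bool)) : Prop :=
  ∀ (s : ℕ → Bool) (n : ℕ), ∃ d ∈ D, ∀ i < n, d i = s i

/-- Coordinate `i` of `g z` is read off any pair of `R` whose first entry agrees with `z` through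
`i`; `SplitAlike` makes the choice irrelevant. -/
theorem exists_extension {R : Set ((ℕ → Bool) × (ℕ → Bool))}
    (hR : ∀ p ∈ R, ∀ q ∈ R, SplitAlike p q) (hd : MeetsCylinders (Prod.fst '' R)) :
    ∃ g : (ℕ → Bool) → (ℕ → Bool), Continuous g ∧
      ∀ p ∈ R, ∀ z n, (∀ i < n, p.1 i = z i) → ∀ i < n, p.2 i = g z i := by
  have key : ∀ (z : ℕ → Bool) (n : ℕ), ∃ p ∈ R, ∀ i < n + 1, p.1 i = z i := by
    intro z n
    obtain ⟨_, ⟨p, hp, rfl⟩, h⟩ := hd z (n + 1)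
    exact ⟨p, hp, h⟩
  choose P hPR hP using key
  have hg : ∀ p ∈ R, ∀ z n, (∀ i < n, p.1 i = z i) → ∀ i < n, p.2 i = (P z i).2 i := by
    intro p hp z n h i hi
    refine (hR p hp _ (hPR z i) (i + 1)).1 (fun j hj => ?_) i (Nat.lt_succ_self i)
    rw [h j (by omega), hP z i j hj]
  refine ⟨fun z i => (P z i).2 i, ?_, hg⟩
  refine continuous_pi fun i => ?_
  refine IsLocallyConstant.continuous ((IsLocallyConstant.iff_eventually_eq _).2 fun z => ?_)
  have hopen : ∀ᶠ w in nhds z, ∀ j < i + 1, w j = z j := by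
    have := (Set.finite_Iio (i + 1)).eventually_all (l := nhds z)
      (p := fun j (w : ℕ → Bool) => w j = z j)
    refine this.2 fun j _ => ?_
    exact ((continuous_apply j).continuousAt.eventually_mem
      ((isOpen_discrete {z j}).mem_nhds rfl))
  filter_upwards [hopen] with w hw
  refine (hg (P z i) (hPR z i) w (i + 1) (fun j hj => ?_) i (Nat.lt_succ_self i)).symm
  rw [hP z i j hj, hw j hj]

theorem exists_homeomorph_extension {R : Set ((ℕ → Bool) × (ℕ → Bool))}
    (hR : ∀ p ∈ R, ∀ q ∈ R, SplitAlike p q)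
    (hd₁ : MeetsCylinders (Prod.fst '' R)) (hd₂ : MeetsCylinders (Prod.snd '' R)) :
    ∃ h : (ℕ → Bool) ≃ₜ (ℕ → Bool),
      ∀ p ∈ R, ∀ z n, (∀ i < n, p.1 i = z i) → ∀ i < n, p.2 i = h z i := by
  obtain ⟨g, hgc, hg⟩ := exists_extension hR hd₁
  have hR' : ∀ p ∈ Prod.swap '' R, ∀ q ∈ Prod.swap '' R, SplitAlike p q := by
    rintro _ ⟨p, hp, rfl⟩ _ ⟨q, hq, rfl⟩
    exact (hR p hp q hq).swap
  obtain ⟨k, hkc, hk⟩ := exists_extension hR' (by simpa [Set.image_image] using hd₂)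
  have hk' : ∀ p ∈ R, ∀ z n, (∀ i < n, p.2 i = z i) → ∀ i < n, p.1 i = k z i :=
    fun p hp z n => hk p.swap ⟨p, hp, rfl⟩ z n
  refine ⟨⟨⟨g, k, fun z => ?_, fun z => ?_⟩, hgc, hkc⟩, hg⟩
  · funext i
    obtain ⟨_, ⟨p, hp, rfl⟩, h⟩ := hd₁ z (i + 1)
    rw [← hk' p hp (g z) (i + 1) (hg p hp z (i + 1) h) i (Nat.lt_succ_self i),
      h i (Nat.lt_succ_self i)]
  · funext i
    obtain ⟨_, ⟨p, hp, rfl⟩, h⟩ := hd₂ z (i + 1)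
    rw [← hg p hp (k z) (i + 1) (hk' p hp z (i + 1) h) i (Nat.lt_succ_self i),
      h i (Nat.lt_succ_self i)]

/-! ### Back-and-forth with fixed coordinates -/

/-- Relative to `x`, every point of `D` is approximated off `x` in every way by points of `E`
that coincide with it on `x`. -/
def FibrewiseDense (x : Set ℕ) (D E : Set (ℕ → Bool)) : Prop :=
  ∀ d ∈ D, ∀ (t : ℕ → Bool) (n : ℕ), ∃ e ∈ E, (∀ i ∈ x, e i = d i) ∧ ∀ i < n, i ∉ x → e i = t i

/-- For a new `d`, only the pair `p` whose first entry agrees longest with `d` matters: `e` must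
leave `p.2` exactly where `d` leaves `p.1`. On `x` this is automatic, since `p.2 = p.1` and `e = d`
there. -/
theorem FibrewiseDense.exists_splitAlike {x : Set ℕ} {D E : Set (ℕ → Bool)}
    (hDE : FibrewiseDense x D E) {S : Finset ((ℕ → Bool) × (ℕ → Bool))}
    (hSE : ∀ p ∈ S, p.2 ∈ E) (hSx : ∀ p ∈ S, ∀ i ∈ x, p.2 i = p.1 i)
    (hS : ∀ p ∈ S, ∀ q ∈ S, SplitAlike p q) {d : ℕ → Bool} (hd : d ∈ D) :
    ∃ e ∈ E, (∀ i ∈ x, e i = d i) ∧ ∀ p ∈ S, SplitAlike p (d, e) := by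
  by_cases hmem : ∃ p ∈ S, p.1 = d
  · obtain ⟨p, hp, rfl⟩ := hmem
    exact ⟨p.2, hSE p hp, hSx p hp, fun q hq => hS q hq p hp⟩
  push Not at hmem
  rcases S.eq_empty_or_nonempty with rfl | hne
  · obtain ⟨e, he, hex, -⟩ := hDE d hd d 0
    exact ⟨e, he, hex, by simp⟩
  obtain ⟨p, hp, hmax⟩ := S.exists_max_image (fun p => PiNat.firstDiff p.1 d) hne
  set l := PiNat.firstDiff p.1 d with hl
  have hpl : p.1 l ≠ d l := PiNat.apply_firstDiff_ne (hmem p hp)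
  have hpd : ∀ i < l, p.1 i = d i := fun i hi => PiNat.apply_eq_of_lt_firstDiff hi
  obtain ⟨e, he, hex, het⟩ := hDE d hd (fun i => if i < l then p.2 i else !p.2 l) (l + 1)
  have hel : ∀ i < l, p.2 i = e i := by
    intro i hi
    by_cases hix : i ∈ x
    · rw [hex i hix, hSx p hp i hix, hpd i hi]
    · rw [het i (by omega) hix, if_pos hi]
  have hne : p.2 l ≠ e l := by
    by_cases hix : l ∈ x
    · rwa [hex l hix, hSx p hp l hix]
    · rw [het l (by omega) hix, if_neg (lt_irrefl l)]
      cases p.2 l <;> simp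
  refine ⟨e, he, hex, fun q hq n => ?_⟩
  have hlow : ∀ n ≤ l, (∀ i < n, q.1 i = d i) ↔ ∀ i < n, q.2 i = e i := by
    intro n hn
    have h := hS q hq p hp n
    constructor
    · intro h1 i hi
      rw [h.1 (fun j hj => by rw [h1 j hj, hpd j (by omega)]) i hi, hel i (by omega)]
    · intro h1 i hi
      rw [h.2 (fun j hj => by rw [h1 j hj, hel j (by omega)]) i hi, hpd i (by omega)]
  rcases le_or_gt n l with hn | hn
  · exact hlow n hn
  have hqne := PiNat.apply_firstDiff_ne (hmem q hq)
  have hql := hmax q hq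
  refine iff_of_false (fun h => hqne (h _ (by omega))) fun h => ?_
  have h1 := (hlow l le_rfl).2 fun i hi => h i (by omega)
  have heq : PiNat.firstDiff q.1 d = l := by
    refine le_antisymm hql (not_lt.1 fun hlt => hqne (h1 _ hlt))
  rw [heq] at hqne
  -- With only two values available, `q.1` and `p.1`, both differing from `d` at `l`, agree there.
  have h2 : ∀ i < l + 1, q.1 i = p.1 i := by
    intro i hi
    rcases Nat.lt_succ_iff_lt_or_eq.1 hi with hi | rfl
    · rw [h1 i hi, hpd i hi]
    · exact (Bool.eq_not_of_ne hqne).trans (Bool.eq_not_of_ne hpl).symm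
  exact hne (((hS q hq p hp (l + 1)).1 h2 l (by omega)).symm.trans (h l hn))

/-- Finite approximations of an isometric bijection from `D` to `E` that does not change
coordinates in `x`. -/
def FiniteApprox (x : Set ℕ) (D E : Set (ℕ → Bool)) : Type :=
  {S : Finset ((ℕ → Bool) × (ℕ → Bool)) //
    (∀ p ∈ S, p.1 ∈ D ∧ p.2 ∈ E ∧ ∀ i ∈ x, p.2 i = p.1 i) ∧ ∀ p ∈ S, ∀ q ∈ S, SplitAlike p q}

instance (x : Set ℕ) (D E : Set (ℕ → Bool)) : Preorder (FiniteApprox x D E) :=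
  inferInstanceAs (Preorder (Subtype _))

instance (x : Set ℕ) (D E : Set (ℕ → Bool)) : Inhabited (FiniteApprox x D E) :=
  ⟨⟨∅, by simp, by simp⟩⟩

theorem FiniteApprox.exists_insert {x : Set ℕ} {D E : Set (ℕ → Bool)} (S : FiniteApprox x D E)
    {d e : ℕ → Bool} (hd : d ∈ D) (he : e ∈ E) (hx : ∀ i ∈ x, e i = d i)
    (h : ∀ p ∈ S.1, SplitAlike p (d, e)) : ∃ T : FiniteApprox x D E, (d, e) ∈ T.1 ∧ S ≤ T := by
  classical
  refine ⟨⟨insert (d, e) S.1, ?_, ?_⟩, Finset.mem_insert_self _ _,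
    show S.1 ⊆ _ from Finset.subset_insert _ _⟩
  · simp only [Finset.forall_mem_insert]
    exact ⟨⟨hd, he, hx⟩, S.2.1⟩
  · simp only [Finset.forall_mem_insert]
    exact ⟨⟨SplitAlike.refl _, fun p hp => (h p hp).symm⟩, fun p hp => ⟨h p hp, S.2.2 p hp⟩⟩

theorem FibrewiseDense.exists_insert_left {x : Set ℕ} {D E : Set (ℕ → Bool)}
    (hDE : FibrewiseDense x D E) {d : ℕ → Bool} (hd : d ∈ D) (S : FiniteApprox x D E) :
    ∃ T : FiniteApprox x D E, (∃ e, (d, e) ∈ T.1) ∧ S ≤ T := by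
  obtain ⟨e, he, hx, h⟩ := hDE.exists_splitAlike (fun p hp => (S.2.1 p hp).2.1)
    (fun p hp => (S.2.1 p hp).2.2) S.2.2 hd
  obtain ⟨T, hT, hST⟩ := S.exists_insert hd he hx h
  exact ⟨T, ⟨e, hT⟩, hST⟩

theorem FibrewiseDense.exists_insert_right {x : Set ℕ} {D E : Set (ℕ → Bool)}
    (hED : FibrewiseDense x E D) {e : ℕ → Bool} (he : e ∈ E) (S : FiniteApprox x D E) :
    ∃ T : FiniteApprox x D E, (∃ d, (d, e) ∈ T.1) ∧ S ≤ T := by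
  classical
  obtain ⟨d, hd, hx, h⟩ := hED.exists_splitAlike (S := S.1.image Prod.swap)
    (Finset.forall_mem_image.2 fun p hp => (S.2.1 p hp).1)
    (Finset.forall_mem_image.2 fun p hp i hi => ((S.2.1 p hp).2.2 i hi).symm)
    (by
      simp only [Finset.forall_mem_image]
      exact fun p hp q hq => (S.2.2 p hp q hq).swap) he
  simp only [Finset.forall_mem_image] at h
  obtain ⟨T, hT, hST⟩ := S.exists_insert hd he (fun i hi => (hx i hi).symm)
    fun p hp => (h hp).swap
  exact ⟨T, ⟨d, hT⟩, hST⟩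

theorem FibrewiseDense.exists_homeomorph {x : Set ℕ} {D E : Set (ℕ → Bool)}
    (hDc : D.Countable) (hEc : E.Countable) (hD : MeetsCylinders D) (hE : MeetsCylinders E)
    (hDE : FibrewiseDense x D E) (hED : FibrewiseDense x E D) :
    ∃ h : (ℕ → Bool) ≃ₜ (ℕ → Bool), h '' D = E ∧ ∀ z, ∀ i ∈ x, h z i = z i := by
  have := hDc.toEncodable
  have := hEc.toEncodable
  -- One cofinal requirement per point of `D` and of `E`; a generic ideal meets them all.
  let C : D ⊕ E → Order.Cofinal (FiniteApprox x D E) := Sum.elim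
    (fun d => ⟨{T | ∃ e, (d.1, e) ∈ T.1}, fun S => hDE.exists_insert_left d.2 S⟩)
    (fun e => ⟨{T | ∃ d, (d, e.1) ∈ T.1}, fun S => hED.exists_insert_right e.2 S⟩)
  let J := Order.idealOfCofinals default C
  let R : Set ((ℕ → Bool) × (ℕ → Bool)) := {p | ∃ S ∈ J, p ∈ S.1}
  have hR : ∀ p ∈ R, ∀ q ∈ R, SplitAlike p q := by
    rintro p ⟨S, hS, hp⟩ q ⟨T, hT, hq⟩
    obtain ⟨U, -, hSU, hTU⟩ := J.directed S hS T hT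
    exact U.2.2 p (hSU hp) q (hTU hq)
  have hRD : ∀ p ∈ R, p.1 ∈ D ∧ p.2 ∈ E ∧ ∀ i ∈ x, p.2 i = p.1 i := by
    rintro p ⟨S, -, hp⟩
    exact S.2.1 p hp
  have hfst : Prod.fst '' R = D := by
    refine Set.Subset.antisymm (Set.image_subset_iff.2 fun p hp => (hRD p hp).1) fun d hd => ?_
    obtain ⟨S, ⟨e, he⟩, hS⟩ := Order.cofinal_meets_idealOfCofinals default C (Sum.inl ⟨d, hd⟩)
    exact ⟨(d, e), ⟨S, hS, he⟩, rfl⟩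
  have hsnd : Prod.snd '' R = E := by
    refine Set.Subset.antisymm (Set.image_subset_iff.2 fun p hp => (hRD p hp).2.1) fun e he => ?_
    obtain ⟨S, ⟨d, hd⟩, hS⟩ := Order.cofinal_meets_idealOfCofinals default C (Sum.inr ⟨e, he⟩)
    exact ⟨(d, e), ⟨S, hS, hd⟩, rfl⟩
  obtain ⟨h, hh⟩ := exists_homeomorph_extension hR (hfst ▸ hD) (hsnd ▸ hE)
  have hval : ∀ p ∈ R, h p.1 = p.2 := fun p hp =>
    funext fun i => (hh p hp p.1 (i + 1) (fun _ _ => rfl) i (Nat.lt_succ_self i)).symm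
  refine ⟨h, ?_, fun z i hi => ?_⟩
  · rw [← hfst, ← hsnd, Set.image_image]
    exact Set.image_congr hval
  · obtain ⟨_, hd, hdz⟩ := hD z (i + 1)
    rw [← hfst] at hd
    obtain ⟨p, hp, rfl⟩ := hd
    rw [← hh p hp z (i + 1) hdz i (Nat.lt_succ_self i), (hRD p hp).2.2 i hi,
      hdz i (Nat.lt_succ_self i)]

/-! ### Non-meagerness and interval partitions -/

/-- Talagrand's condition: for every partition of `ℕ` into intervals, some member of the filter
misses infinitely many of the intervals. -/
def MissesIntervals (F : Filter ℕ) : Prop :=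
  ∀ u : ℕ → ℕ, StrictMono u → ∃ A ∈ F, ∀ m, ∃ k ≥ m, ∀ i ∈ A, i ∉ Set.Ico (u k) (u (k + 1))

theorem isMeagre_of_not_missesIntervals {F : Filter ℕ} (h : ¬ MissesIntervals F) :
    IsMeagre (cantorFamily F) := by
  simp only [MissesIntervals, not_forall] at h
  obtain ⟨u, hu, hF⟩ := h
  push Not at hF
  have hsub : cantorFamily F ⊆
      ⋃ m, {z : ℕ → Bool | ∀ k ≥ m, ∃ i ∈ Set.Ico (u k) (u (k + 1)), z i = true} := by
    intro z hz
    obtain ⟨m, hm⟩ := hF _ hz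
    refine Set.mem_iUnion.2 ⟨m, fun k hk => ?_⟩
    obtain ⟨i, hi, hik⟩ := hm k hk
    exact ⟨i, hik, hi⟩
  refine IsMeagre.mono hsub ?_
  refine isMeagre_iUnion fun m => IsNowhereDense.isMeagre ?_
  have hclosed : IsClosed
      {z : ℕ → Bool | ∀ k ≥ m, ∃ i ∈ Set.Ico (u k) (u (k + 1)), z i = true} := by
    simp only [Set.ofPred_forall]
    refine isClosed_iInter fun k => isClosed_iInter fun _ => ?_
    have : {z : ℕ → Bool | ∃ i ∈ Set.Ico (u k) (u (k + 1)), z i = true} =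
        ⋃ i ∈ Set.Ico (u k) (u (k + 1)), {z : ℕ → Bool | z i = true} := by
      ext z; simp
    rw [this]
    exact (Set.finite_Ico _ _).isClosed_biUnion fun i _ =>
      isClosed_eq (continuous_apply i) continuous_const
  rw [hclosed.isNowhereDense_iff, Set.eq_empty_iff_forall_notMem]
  intro z hz
  obtain ⟨_, ⟨y, n, rfl⟩, hzy, hy⟩ :=
    (PiNat.isTopologicalBasis_cylinders (fun _ => Bool)).mem_nhds_iff.1
      (isOpen_interior.mem_nhds hz)
  -- Continuing by `false` beyond `n` misses every late interval, so the closed set has empty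
  -- interior.
  have hmem : (fun i => if i < n then z i else false) ∈ PiNat.cylinder y n := by
    intro i hi
    simpa [hi] using hzy i hi
  obtain ⟨i, hi, hit⟩ := interior_subset (hy hmem) (max m n) (le_max_left _ _)
  have h1 : n ≤ i := (le_max_right m n).trans ((hu.id_le _).trans hi.1)
  simp [Nat.not_lt.2 h1] at hit

theorem exists_strictMono_of_exists {Q : ℕ → ℕ → Prop}
    (hQ : ∀ n, ∃ m, ∀ m' ≥ m, Q n m') : ∃ u : ℕ → ℕ, StrictMono u ∧ ∀ k, Q (u k) (u (k + 1)) := by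
  choose f hf using hQ
  let u : ℕ → ℕ := fun k => Nat.rec 0 (fun _ n => max (n + 1) (f n)) k
  exact ⟨u, strictMono_nat_of_lt_succ fun k => lt_of_lt_of_le (Nat.lt_succ_self _)
    (le_max_left _ _), fun k => hf _ _ (le_max_right _ _)⟩

/-- If all members of `E` contain `x` up to finitely many points, the points of `E` realizing the
finitely many patterns below `n` can be chosen to contain `x` beyond a common bound. -/
theorem MeetsCylinders.exists_bound {E : Set (ℕ → Bool)} (hE : MeetsCylinders E) {x : Set ℕ}
    (hx : ∀ e ∈ E, {i ∈ x | e i = false}.Finite) (n : ℕ) :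
    ∃ m, ∀ m' ≥ m, ∀ s : ℕ → Bool, ∃ e ∈ E, (∀ i < n, e i = s i) ∧
      ∀ i ∈ x, m' ≤ i → e i = true := by
  have key : ∀ s : Fin n → Bool, ∃ e ∈ E, ∃ m, (∀ i : Fin n, e i = s i) ∧
      ∀ i ∈ x, m ≤ i → e i = true := by
    intro s
    obtain ⟨e, he, hes⟩ := hE (fun i => if h : i < n then s ⟨i, h⟩ else true) n
    obtain ⟨m, hm⟩ := (hx e he).bddAbove
    refine ⟨e, he, m + 1, fun i => by simpa using hes i i.2, fun i hi hmi => ?_⟩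
    by_contra hc
    have := hm (show i ∈ {i ∈ x | e i = false} from ⟨hi, by simpa using hc⟩)
    omega
  choose e he m hes hm using key
  refine ⟨Finset.univ.sup m, fun m' hm' s => ⟨e fun i => s i, he _, fun i hi => hes _ ⟨i, hi⟩,
    fun i hi hi' => hm _ i hi (le_trans ?_ (hm'.trans hi'))⟩⟩
  exact Finset.le_sup (f := m) (Finset.mem_univ _)

/-- Take a late interval missed by `y`. Before it, `e` is prescribed as `d` on `y` and `t`
elsewhere; after it, both `d` and `e` are `true` on `y`; inside it there is nothing to match. -/
theorem fibrewiseDense_of_intervals {x y : Set ℕ} {D E : Set (ℕ → Bool)} {u : ℕ → ℕ}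
    (hu : StrictMono u) (hyx : y ⊆ x) (hx : ∀ d ∈ D, {i ∈ x | d i = false}.Finite)
    (hE : ∀ k, ∀ s : ℕ → Bool, ∃ e ∈ E, (∀ i < u k, e i = s i) ∧
      ∀ i ∈ x, u (k + 1) ≤ i → e i = true)
    (hy : ∀ m, ∃ k ≥ m, ∀ i ∈ y, i ∉ Set.Ico (u k) (u (k + 1))) :
    FibrewiseDense y D E := by
  classical
  intro d hd t n
  obtain ⟨m, hm⟩ := (hx d hd).bddAbove
  obtain ⟨k, hk, hky⟩ := hy (max n (m + 1))
  obtain ⟨e, he, hes, hex⟩ := hE k fun i => if i ∈ y then d i else t i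
  have huk : max n (m + 1) ≤ u k := hk.trans (hu.id_le k)
  have hnu : n ≤ u k := (le_max_left _ _).trans huk
  have hmu : m + 1 ≤ u k := (le_max_right _ _).trans huk
  refine ⟨e, he, fun i hi => ?_, fun i hi hiy => ?_⟩
  · rcases lt_or_ge i (u k) with h1 | h1
    · rw [hes i h1, if_pos hi]
    · have h2 : u (k + 1) ≤ i := not_lt.1 fun h => hky i hi ⟨h1, h⟩
      have hdi : d i = true := by
        by_contra hc
        have := hm (show i ∈ {i ∈ x | d i = false} from ⟨hyx hi, by simpa using hc⟩)
        omega
      rw [hex i (hyx hi) h2, hdi]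
  · rw [hes i (by omega), if_neg hiy]

/-! ### Homogeneity of the filter -/

theorem meetsCylinders_image_val {F : Filter ℕ} (hF : ∀ A : Set ℕ, Aᶜ.Finite → A ∈ F)
    {D : Set (cantorFamily F)} (hD : Dense D) : MeetsCylinders (Subtype.val '' D) := by
  intro s n
  -- The default `true` makes the point cofinite, hence a member of the filter.
  have hz : (fun i => if i < n then s i else true) ∈ cantorFamily F := by
    refine hF _ ((Set.finite_Iio n).subset fun i hi => ?_)
    by_contra hc
    simp at hc
    simp [Nat.not_lt.2 hc] at hi
  obtain ⟨d, hdU, hdD⟩ := hD.inter_open_nonempty _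
    ((PiNat.isOpen_cylinder (fun _ => Bool) (fun i => if i < n then s i else true) n).preimage
      (continuous_subtype_val (p := (· ∈ cantorFamily F)))) ⟨⟨_, hz⟩, PiNat.self_mem_cylinder _ _⟩
  refine ⟨d, ⟨d, hdD, rfl⟩, fun i hi => ?_⟩
  simpa [hi] using hdU i hi

theorem IsPFilter.exists_almost_subset {F : Filter ℕ} (hP : IsPFilter F)
    {D : Set (ℕ → Bool)} (hD : D.Countable) (hDF : D ⊆ cantorFamily F) :
    ∃ x ∈ F, ∀ d ∈ D, {i ∈ x | d i = false}.Finite := by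
  rcases D.eq_empty_or_nonempty with rfl | hne
  · exact ⟨Set.univ, Filter.univ_mem, by simp⟩
  obtain ⟨f, rfl⟩ := hD.exists_eq_range hne
  obtain ⟨x, hx, h⟩ := hP (fun n => {i | f n i = true}) fun n => hDF ⟨n, rfl⟩
  refine ⟨x, hx, ?_⟩
  rintro _ ⟨n, rfl⟩
  exact (h n).subset fun i hi => ⟨hi.1, by simp [hi.2]⟩

theorem isCDH_cantorFamily {F : Filter ℕ} (hF : ∀ A : Set ℕ, Aᶜ.Finite → A ∈ F)
    (hP : IsPFilter F) (hM : MissesIntervals F) : IsCDH (cantorFamily F) := by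
  refine ⟨inferInstance, fun D E hDc hD hEc hE => ?_⟩
  have hDm := meetsCylinders_image_val hF hD
  have hEm := meetsCylinders_image_val hF hE
  have hDc' := hDc.image Subtype.val
  have hEc' := hEc.image Subtype.val
  obtain ⟨x, hxF, hx⟩ := hP.exists_almost_subset (hDc'.union hEc') (by
    rintro _ (⟨d, -, rfl⟩ | ⟨d, -, rfl⟩) <;> exact d.2)
  have hxD := fun d hd => hx d (Or.inl hd)
  have hxE := fun d hd => hx d (Or.inr hd)
  obtain ⟨u, hu, hQ⟩ := exists_strictMono_of_exists fun n => by
    obtain ⟨m₁, h₁⟩ := hDm.exists_bound hxD n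
    obtain ⟨m₂, h₂⟩ := hEm.exists_bound hxE n
    exact ⟨max m₁ m₂, fun m' hm' => And.intro (h₁ m' ((le_max_left _ _).trans hm'))
      (h₂ m' ((le_max_right _ _).trans hm'))⟩
  obtain ⟨A, hA, hAu⟩ := hM u hu
  have hy : ∀ m, ∃ k ≥ m, ∀ i ∈ x ∩ A, i ∉ Set.Ico (u k) (u (k + 1)) := fun m =>
    let ⟨k, hk, h⟩ := hAu m
    ⟨k, hk, fun i hi => h i hi.2⟩
  obtain ⟨h, hDE, hfix⟩ := FibrewiseDense.exists_homeomorph hDc' hEc' hDm hEm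
    (fibrewiseDense_of_intervals hu Set.inter_subset_left hxD (fun k => (hQ k).2) hy)
    (fibrewiseDense_of_intervals hu Set.inter_subset_left hxE (fun k => (hQ k).1) hy)
  have hpres : ∀ z, z ∈ cantorFamily F ↔ h z ∈ cantorFamily F := by
    intro z
    refine Filter.congr_sets ?_
    filter_upwards [Filter.inter_mem hxF hA] with i hi
    show z i = true ↔ h z i = true
    rw [hfix z i hi]
  refine ⟨h.subtype hpres, ?_⟩
  apply Subtype.val_injective.image_injective
  rw [← hDE, Set.image_image, Set.image_image]
  rfl

/-! ### Passage to the countable power -/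

theorem IsCDH.of_homeomorph {X Y : Type*} [TopologicalSpace X] [TopologicalSpace Y]
    (f : X ≃ₜ Y) (hX : IsCDH X) : IsCDH Y := by
  have := hX.1
  refine ⟨f.surjective.denseRange.separableSpace f.continuous, fun D E hDc hD hEc hE => ?_⟩
  obtain ⟨h, hh⟩ := hX.2 (f.symm '' D) (f.symm '' E) (hDc.image _)
    (f.symm.surjective.denseRange.dense_image f.symm.continuous hD) (hEc.image _)
    (f.symm.surjective.denseRange.dense_image f.symm.continuous hE)
  refine ⟨(f.symm.trans h).trans f, ?_⟩
  have : (f.symm.trans h).trans f '' D = f '' (h '' (f.symm '' D)) := by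
    simp only [Set.image_image]
    rfl
  rw [this, hh]
  simp [Set.image_image]

/-- The filter on `ℕ ≃ ℕ × ℕ` of the sets all of whose vertical sections are in `F`. -/
def sectionFilter (F : Filter ℕ) : Filter ℕ :=
  ⨆ n, F.map (Nat.pair n)

theorem mem_sectionFilter {F : Filter ℕ} {A : Set ℕ} :
    A ∈ sectionFilter F ↔ ∀ n, {m | Nat.pair n m ∈ A} ∈ F := by
  simp [sectionFilter, Filter.mem_iSup, Filter.mem_map, Set.preimage]

theorem sectionFilter_cofinite {F : Filter ℕ} (hF : ∀ A : Set ℕ, Aᶜ.Finite → A ∈ F)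
    (A : Set ℕ) (hA : Aᶜ.Finite) : A ∈ sectionFilter F := by
  refine mem_sectionFilter.2 fun n => hF _ ?_
  exact hA.preimage (f := Nat.pair n) fun a _ b _ h => (Nat.pair_eq_pair.1 h).2

theorem IsPFilter.sectionFilter {F : Filter ℕ} (hP : IsPFilter F) :
    IsPFilter (sectionFilter F) := by
  intro X hX
  have hX' : ∀ k n, {m | Nat.pair n m ∈ X k} ∈ F := fun k => mem_sectionFilter.1 (hX k)
  choose Y hY hYX using fun n => hP (fun k => {m | Nat.pair n m ∈ X k}) fun k => hX' k n
  -- Diagonalization: column `n` lies inside `X k` for all `k ≤ n`, so only the columns `n < k` can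
  -- leave `X k`, each in a finite set.
  refine ⟨{a | a.unpair.2 ∈ Y a.unpair.1 ∧ ∀ k ≤ a.unpair.1, a ∈ X k}, ?_, fun k => ?_⟩
  · refine mem_sectionFilter.2 fun n => ?_
    have h2 : (⋂ k ∈ Set.Iic n, {m | Nat.pair n m ∈ X k}) ∈ F :=
      (Filter.biInter_mem (Set.finite_Iic n)).2 fun k _ => hX' k n
    filter_upwards [hY n, h2] with m hm hm2
    simp only [Set.mem_iInter, Set.mem_Iic, Set.mem_ofPred_eq] at hm2
    simpa using ⟨hm, hm2⟩
  · refine ((Set.finite_Iio k).biUnion fun n _ => (hYX n k).image (Nat.pair n)).subset ?_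
    rintro a ⟨⟨ha, hak⟩, hna⟩
    refine Set.mem_biUnion (x := a.unpair.1) (not_le.1 fun h => hna (hak k h))
      ⟨a.unpair.2, ⟨ha, ?_⟩, Nat.pair_unpair a⟩
    simpa using hna

/-- For `n ≤ m`, `m ∈ A`, a code `Nat.pair n m` in the `u`-interval of index `v k ^ 2` has `m < v (k
+ 1)`. If `A` misses the `k`-th `v`-interval, then `m < v k`, so the code is below `v k ^ 2`, too
small for that `u`-interval. Deleting these `u`-intervals thus keeps every section in `F`. -/
theorem MissesIntervals.sectionFilter {F : Filter ℕ} (hF : ∀ A : Set ℕ, Aᶜ.Finite → A ∈ F)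
    (hM : MissesIntervals F) : MissesIntervals (sectionFilter F) := by
  intro u hu
  obtain ⟨v, hv, hvu⟩ := exists_strictMono_of_exists (Q := fun n m => u (n ^ 2 + 1) ≤ m)
    fun n => ⟨_, fun _ h => h⟩
  obtain ⟨A, hA, hAv⟩ := hM v hv
  refine ⟨{a | ∀ k, (∀ i ∈ A, i ∉ Set.Ico (v k) (v (k + 1))) →
    a ∉ Set.Ico (u (v k ^ 2)) (u (v k ^ 2 + 1))}, mem_sectionFilter.2 fun n => ?_, fun m => ?_⟩
  · have hn : Set.Ici n ∈ F := hF _ (by simp [Set.finite_Iio])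
    filter_upwards [hA, hn] with m hm hnm k hk hmem
    have h1 : m < v (k + 1) :=
      (Nat.right_le_pair n m).trans_lt (hmem.2.trans_le (hvu k))
    have h2 : m < v k := not_le.1 fun h => hk m hm ⟨h, h1⟩
    have h3 : Nat.pair n m < v k ^ 2 :=
      (Nat.pair_lt_max_add_one_sq n m).trans_le (Nat.pow_le_pow_left
        (by rw [max_eq_right (show n ≤ m from hnm)]; exact h2) 2)
    exact absurd (h3.trans_le (hu.id_le _)) (not_lt.2 hmem.1)
  · obtain ⟨k, hk, hkA⟩ := hAv m
    exact ⟨v k ^ 2, (hk.trans (hv.id_le k)).trans (Nat.le_self_pow two_ne_zero _),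
      fun a ha => ha k hkA⟩

/-- The countable power of a family given by a filter is the family given by the section filter. -/
def cantorFamilyPowerHomeomorph (F : Filter ℕ) :
    cantorFamily (sectionFilter F) ≃ₜ (ℕ → cantorFamily F) where
  toFun z n := ⟨fun m => z.1 (Nat.pair n m), mem_sectionFilter.1 z.2 n⟩
  invFun w := ⟨fun a => (w a.unpair.1).1 a.unpair.2, mem_sectionFilter.2 fun n => by
    have : {m | (w n).1 m = true} ∈ F := (w n).2
    simpa only [Set.mem_ofPred_eq, Nat.unpair_pair] using this⟩
  left_inv z := by
    ext a
    simp
  right_inv w := by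
    ext n m
    simp
  continuous_toFun := continuous_pi fun n => Continuous.subtype_mk
    (continuous_pi fun m => show Continuous fun z : cantorFamily (sectionFilter F) =>
      z.1 (Nat.pair n m) from (continuous_apply _).comp continuous_subtype_val) _
  continuous_invFun := Continuous.subtype_mk (continuous_pi fun a : ℕ =>
    show Continuous fun w : ℕ → cantorFamily F => (w a.unpair.1).1 a.unpair.2 from
      (continuous_apply a.unpair.2).comp
        (continuous_subtype_val.comp (continuous_apply a.unpair.1))) _

theorem theorem1p4 (F : Filter ℕ) [F.NeBot]
    (hFrechet : ∀ A : Set ℕ, Aᶜ.Finite → A ∈ F)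
    (hP : IsPFilter F)
    (hnm : ¬ IsMeagre (cantorFamily F)) :
    IsCDH (cantorFamily F) ∧ IsCDH (ℕ → cantorFamily F) := by
  have hM : MissesIntervals F := not_not.1 fun h => hnm (isMeagre_of_not_missesIntervals h)
  exact ⟨isCDH_cantorFamily hFrechet hP hM,
    (isCDH_cantorFamily (sectionFilter_cofinite hFrechet) hP.sectionFilter
      (hM.sectionFilter hFrechet)).of_homeomorph (cantorFamilyPowerHomeomorph F)⟩
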